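/- Let $\mathbb{F}_q$ be a finite field, and let $\lambda\ge 2$ and $k^I>r^F>r^I\ge 0$ be integers. Put $g=\gcd(r^F,r^I)$, $\alpha=r^F/g$, $\beta=r^I/g$, $n^I=k^I+r^I$, $k^F=\lambda k^I$ and $n^F=\lambda k^I+r^F$. **Notions.** An $[n,k,\alpha]$ vector code encodes $k$ message symbols in $\mathbb{F}_q^\alpha$ into $n$ code symbols in $\mathbb{F}_q^\alpha$; it is *MDS* if any $k$ code symbols determine the message. A linear scalar $[n,k]$ code is MDS if its minimum distance is $n-k+1$. A *conversion procedure* from an $[n^I,k^I,\alpha]$ code $\mathcal C^I$ to an $[n^F,\lambda k^I,\alpha]$ code $\mathcal C^F$ takes the codewords of $\mathcal C^I$ that encode $m^1,\dots,m^\lambda$, with all symbols stored on distinct disks, to the codeword of $\mathcal C^F$ that encodes $(m^1,\dots,m^\lambda)$, also with its symbols on distinct disks. Some final disks are initial disks that are kept unchanged; the initial disks not kept are retired; the remaining final disks are new. A central coordinator receives from each initial disk a function of its content and sends data to the new disks, from which they compute their symbols. The *read bandwidth* (resp. *write bandwidth*) is the total number of elements of $\mathbb{F}_q$ sent to (resp.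 by) the coordinator, and the *bandwidth cost* is their sum. The procedure is *bandwidth-optimal* if its cost is minimal among all conversion procedures between all (not necessarily linear) MDS vector codes over $\mathbb{F}_q$ with the same parameters $n^I,k^I,n^F,\lambda k^I,\alpha$. **Base code.** A *base pair* consists of matrices $P^I\in\mathbb{F}_q^{k^I\times r^F}$ and $P^F\in\mathbb{F}_q^{\lambda k^I\times r^F}$ such that $[I\ P^I]$ and $[I\ P^F]$ generate the (MDS) initial and final codes of an access-optimal scalar $(k^I+r^F,k^I;\lambda k^I+r^F,\lambda k^I)$ MDS convertible code (conversion with $\alpha=1$ is possible by reading from exactly $\lambda r^F$ disks, with exactly $r^F$ new disks), and such that the $r^F$ parity symbols of the final codeword are a function of the $r^F$ parity symbols of each of the $\lambda$ initial codewords. Let $p^0,\dots,p^{r^F-1}$ be the columns of $P^I$. **Construction.** For a message $m=(m_0,\dots,m_{\alpha-1})$ with $m_j=(m_{0,j},\dots,m_{k^I-1,j})\in\mathbb{F}_q^{k^I}$, the codeword $(c_i)_{0\le i<n^I}$ of $\mathcal C^I$ is given by $c_{i,j}=m_{i,j}$ for $0\le i<k^I$, and, for $0\le i<r^I$, by $$c_{k^I+i,j}=\begin{cases}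 m_j\cdot p^i, & 0\le j<\beta,\\ m_j\cdot p^i+m_{i_1}\cdot p^{\,r^I+(\alpha-\beta)i_2+(j-\beta)}, & \beta\le j<\alpha,\end{cases}$$ where $i_1=\lfloor i/g\rfloor$ and $i_2=i \bmod g$. The code $\mathcal C^F$ consists of $\alpha$ independent instances of the code generated by $[I\ P^F]$: for each $j$, the $j$-th sub-symbols of the codeword form the codeword that encodes $(m^1_j,\dots,m^\lambda_j)$. **Theorem.** 1. For every base pair, $\mathcal C^I$ is a linear $[n^I,k^I,\alpha]$ MDS vector code, $\mathcal C^F$ is a linear $[n^F,k^F,\alpha]$ MDS vector code, and there is a conversion procedure from $\mathcal C^I$ to $\mathcal C^F$ which keeps exactly the $\lambda k^I$ message disks, reads exactly the sub-symbols with index $j\ge\beta$ of every message disk and all sub-symbols of every parity disk of the initial codewords, has read bandwidth $\lambda\alpha\left(r^I+\left(1-\frac{r^I}{r^F}\right)k^I\right)$ and write bandwidth $r^F\alpha$, and is bandwidth-optimal. 2. If $q\ge n^F-1$, then a base pair over $\mathbb{F}_q$ exists, so that such a bandwidth-optimal convertible code over $\mathbb{F}_q$ exists. -/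

import Mathlib

/-! ### Scalar linear codes -/

/-- The minimum Hamming distance between two distinct codewords of a linear code. -/
noncomputable def minDist {F ν : Type*} [Field F] [Fintype ν] (C : Submodule F (ν → F)) : ℕ :=
  open Classical in sInf {d : ℕ | ∃ c ∈ C, ∃ c' ∈ C, c ≠ c' ∧ d = hammingDist c c'}

/-- A linear code of dimension `k` and length `n = card ν` is MDS if its minimum distance is
`n - k + 1`. -/
def IsScalarMDS {F ν : Type*} [Field F] [Fintype ν] (C : Submodule F (ν → F)) (k : ℕ) : Prop :=
  Module.finrank F C = k ∧ minDist C + k = Fintype.card ν + 1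

/-- The systematic generator matrix `[I P]`. -/
def sysGen {F κ ρ : Type*} [Field F] [DecidableEq κ] (P : Matrix κ ρ F) : Matrix κ (κ ⊕ ρ) F :=
  Matrix.fromCols 1 P

/-- The linear code generated by the rows of `G`. -/
def rowCode {F κ ν : Type*} [Field F] [Fintype κ] (G : Matrix κ ν F) : Submodule F (ν → F) :=
  LinearMap.range G.vecMulLinear

/-! ### Vector codes -/

/-- A vector code with sub-packetization `α` over `F`, given by its encoder: it encodes message
symbols in `F ^ α` indexed by `κ` into code symbols in `F ^ α` indexed by `ν`.  The encoder is not
required to be linear. -/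
structure VectorCode (F κ ν : Type*) (α : ℕ) where
  encode : (κ → Fin α → F) → (ν → Fin α → F)

/-- A vector code is MDS if the message is determined by any `k` code symbols, where `k` is the
number of message symbols. -/
def VectorCode.IsMDS {F κ ν : Type*} [Fintype κ] {α : ℕ} (C : VectorCode F κ ν α) : Prop :=
  ∀ R : Finset ν, R.card = Fintype.card κ →
    ∀ m m' : κ → Fin α → F, (∀ i ∈ R, C.encode m i = C.encode m' i) → m = m'

/-- A vector code is linear if its encoder is. -/
def VectorCode.IsLinear {F κ ν : Type*} [Field F] {α : ℕ} (C : VectorCode F κ ν α) : Prop :=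
  IsLinearMap F C.encode

/-- The vector code formed by `α` independent instances of the scalar code with generator matrix
`G`: for each `j`, the `j`-th sub-symbols form the codeword encoding the `j`-th message vector.
For `α = 1` this is the scalar code itself. -/
def VectorCode.instances {F κ ν : Type*} [Field F] [Fintype κ] (G : Matrix κ ν F) (α : ℕ) :
    VectorCode F κ ν α where
  encode m i j := Matrix.vecMul (fun s => m s j) G i

/-! ### Conversion in the merge regime -/

/-- A procedure, with a central coordinator node, that merges the codewords of `CI` encoding the
messages `M (ℓ, ·)`, `ℓ : L`, into the codeword of `CF` encoding `M`.
Every code symbol is stored on a disk of its own: the initial disks are indexed by `L × ι`, the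
final disks by `ν`. -/
structure Conversion {F L κ ι ν : Type*} {α : ℕ}
    (CI : VectorCode F κ ι α) (CF : VectorCode F (L × κ) ν α) where
  /-- `origin s = some x` if final disk `s` is the unchanged initial disk `x`, and
  `origin s = none` if `s` is a new disk.  Initial disks that are not unchanged are retired. -/
  origin : ν → Option (L × ι)
  origin_inj : ∀ s t x, origin s = some x → origin t = some x → s = t
  /-- An unchanged disk stores the same symbol in both codewords. -/
  unchanged : ∀ s x, origin s = some x →
    ∀ M : L × κ → Fin α → F, CF.encode M s = CI.encode (fun i => M (x.1, i)) x.2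
  /-- The number of elements of `F` sent by an initial disk to the coordinator. -/
  readCount : L × ι → ℕ
  /-- What an initial disk sends to the coordinator, as a function of its content. -/
  read : ∀ x, (Fin α → F) → (Fin (readCount x) → F)
  /-- The number of elements of `F` sent by the coordinator to a new disk. -/
  writeCount : ν → ℕ
  /-- What the coordinator sends to a new disk, as a function of everything it has received. -/
  send : ∀ s, (∀ x, Fin (readCount x) → F) → (Fin (writeCount s) → F)
  /-- What a new disk stores, as a function of what it has received. -/
  store : ∀ s, (Fin (writeCount s) → F) → (Fin α → F)
  /-- The new disks end up with the symbols of the final codeword. -/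
  correct : ∀ s, origin s = none → ∀ M : L × κ → Fin α → F,
    store s (send s (fun x => read x (CI.encode (fun i => M (x.1, i)) x.2))) = CF.encode M s

namespace Conversion

variable {F L κ ι ν : Type*} {α : ℕ} {CI : VectorCode F κ ι α} {CF : VectorCode F (L × κ) ν α}

/-- The number of elements of `F` sent to the coordinator. -/
def readBandwidth [Fintype L] [Fintype ι] (T : Conversion CI CF) : ℕ :=
  ∑ x, T.readCount x

/-- The number of elements of `F` sent by the coordinator to the new disks. -/
def writeBandwidth [Fintype ν] (T : Conversion CI CF) : ℕ :=
  ∑ s with (T.origin s).isNone, T.writeCount s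

/-- The bandwidth cost. -/
def bandwidth [Fintype L] [Fintype ι] [Fintype ν] (T : Conversion CI CF) : ℕ :=
  T.readBandwidth + T.writeBandwidth

/-- The number of initial disks from which something is read. -/
def readAccessCost [Fintype L] [Fintype ι] (T : Conversion CI CF) : ℕ :=
  (Finset.univ.filter fun x => T.readCount x ≠ 0).card

/-- The number of new disks. -/
def writeAccessCost [Fintype ν] (T : Conversion CI CF) : ℕ :=
  (Finset.univ.filter fun s => (T.origin s).isNone).card

/-- Initial disk `x` sends exactly its sub-symbols with index in `S`, uncoded. -/
def ReadsExactly (T : Conversion CI CF) (x : L × ι) (S : Finset (Fin α)) : Prop :=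
  ∃ e : Fin (T.readCount x) ≃ S, ∀ v t, T.read x v t = v (e t)

/-- The conversion has the least bandwidth cost among all conversion procedures between all MDS
vector codes with the same lengths, dimensions and sub-packetization over `F`. -/
def IsBandwidthOptimal [Fintype L] [Fintype κ] [Fintype ι] [Fintype ν]
    (T : Conversion CI CF) : Prop :=
  ∀ (CI' : VectorCode F κ ι α) (CF' : VectorCode F (L × κ) ν α), CI'.IsMDS → CF'.IsMDS →
    ∀ T' : Conversion CI' CF', T.bandwidth ≤ T'.bandwidth

end Conversion

/-! ### The base code -/

/-- `[I PI]` and `[I PF]` generate the initial and the final code of an access-optimal scalar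
`(k + r, k; lam * k + r, lam * k)` MDS convertible code (with systematic linear codes) for which
the `r` parity symbols of the final codeword are a function of the `r` parity symbols of each of
the `lam` initial codewords. -/
structure IsAccessOptimalBase {F : Type*} [Field F] {lam k r : ℕ}
    (PI : Matrix (Fin k) (Fin r) F) (PF : Matrix (Fin lam × Fin k) (Fin r) F) : Prop where
  initial_mds : IsScalarMDS (rowCode (sysGen PI)) k
  final_mds : IsScalarMDS (rowCode (sysGen PF)) (lam * k)
  access_optimal : ∃ T : Conversion (VectorCode.instances (sysGen PI) 1)
      (VectorCode.instances (sysGen PF) 1),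
    T.readAccessCost = lam * r ∧ T.writeAccessCost = r
  parity_computable : ∃ h : (Fin lam → Fin r → F) → Fin r → F,
    ∀ M : Fin lam × Fin k → F,
      Matrix.vecMul M PF = h (fun l => Matrix.vecMul (fun s => M (l, s)) PI)

/-! ### The piggybacked initial code -/

/-- The sub-packetization `α = rF / gcd(rF, rI)`. -/
def subPack (rI rF : ℕ) : ℕ := rF / Nat.gcd rF rI

/-- The number `β = rI / gcd(rF, rI)` of instances of the base code without piggybacks. -/
def subPackFree (rI rF : ℕ) : ℕ := rI / Nat.gcd rF rI

theorem piggyback_instance_lt {rI rF : ℕ} (h : rI < rF) (i : Fin rI) :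
    (i : ℕ) / Nat.gcd rF rI < subPack rI rF := by
  have hg : 0 < Nat.gcd rF rI := Nat.gcd_pos_of_pos_left _ (by omega)
  exact Nat.div_lt_div_of_lt_of_dvd (Nat.gcd_dvd_left rF rI) (i.2.trans h)

theorem piggyback_column_lt {rI rF : ℕ} (h : rI < rF) (i : Fin rI) (j : Fin (subPack rI rF))
    (hj : subPackFree rI rF ≤ j) :
    rI + (subPack rI rF - subPackFree rI rF) * ((i : ℕ) % Nat.gcd rF rI)
      + ((j : ℕ) - subPackFree rI rF) < rF := by
  have hg : 0 < Nat.gcd rF rI := Nat.gcd_pos_of_pos_left _ (by omega)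
  have h1 : subPack rI rF * Nat.gcd rF rI = rF := Nat.div_mul_cancel (Nat.gcd_dvd_left rF rI)
  have h2 : subPackFree rI rF * Nat.gcd rF rI = rI := Nat.div_mul_cancel (Nat.gcd_dvd_right rF rI)
  have h3 : (i : ℕ) % Nat.gcd rF rI + 1 ≤ Nat.gcd rF rI := Nat.mod_lt _ hg
  have h4 := Nat.mul_le_mul_left (subPack rI rF - subPackFree rI rF) h3
  have h5 : (subPack rI rF - subPackFree rI rF) * Nat.gcd rF rI = rF - rI := by
    rw [Nat.sub_mul, h1, h2]
  have h6 := j.2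
  rw [Nat.mul_add, h5] at h4
  omega

/-- The piggybacked initial code with `k` message symbols and `rI` parity symbols.  With `m_j` the
`j`-th message vector, `p^c` the `c`-th column of `PI`, `g = gcd(rF, rI)`, `i₁ = ⌊i / g⌋` and
`i₂ = i mod g`, the `j`-th sub-symbol of the `i`-th parity symbol is `m_j ⬝ p^i` if `j < β`, and
`m_j ⬝ p^i + m_{i₁} ⬝ p^(rI + (α - β) i₂ + (j - β))` if `β ≤ j`. -/
def piggybackCode {F : Type*} [Field F] {k rI rF : ℕ} (h : rI < rF)
    (PI : Matrix (Fin k) (Fin rF) F) :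
    VectorCode F (Fin k) (Fin k ⊕ Fin rI) (subPack rI rF) where
  encode m
    | Sum.inl s => m s
    | Sum.inr i => fun j =>
      Matrix.vecMul (fun s => m s j) PI (Fin.castLE h.le i) +
        if hj : subPackFree rI rF ≤ j then
          Matrix.vecMul (fun s => m s ⟨(i : ℕ) / Nat.gcd rF rI, piggyback_instance_lt h i⟩) PI
            ⟨rI + (subPack rI rF - subPackFree rI rF) * ((i : ℕ) % Nat.gcd rF rI)
              + ((j : ℕ) - subPackFree rI rF), piggyback_column_lt h i j hj⟩
        else 0

/-! ### Scalar MDS codes -/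

/-! Write `k`, `r = rF`, `α`, `β`, `g` as in the construction; everything turns on `α * rI = β *
rF`.

Code and conversion. Piggybacks come only from the first `β` instances, which carry none themselves,
so these decode first and the rest follows by subtraction. Reading the message sub-symbols with
index at least `β` reveals the parities of those instances; subtracting them exposes the piggybacks,
which are exactly the `β * (rF - rI)` base parities missing from the first `β` instances. The final
parities are a function of all these (`piggybackCode_base_parities_eq`).

Lower bound, by counting since codes need not be linear. Let `u` disks of one initial codeword be
kept; `u ≤ k` (`card_kept_le`). Drop at most `r` kept disks `S` from the final codeword and freeze
the other messages: the kept disks outside `S`, with what `S` and the unkept disks send, determine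
the message (`message_le_read`). For `u ≥ r`, taking `S` of size `r` with at most average reads
bounds the total; for `u < r`, `S` is all kept disks. Each disk not kept forces one more new disk
receiving `α` symbols, so keeping fewer than `k` never helps. At `u = k` the bound is the cost of
the construction.

Existence. With `ω` of order `q ^ 2 - 1`, the rows of `singerEntry` are scaled Vandermonde rows with
`q + 1` distinct nodes, so any `r` are independent. Frobenius reverses the columns, so coordinates
of a row in `r` consecutive rows lie in `F`. Shifting the row index scales each column, so final
parities follow from initial ones. -/

theorem vecMul_sysGen_inl {F κ ρ : Type*} [Field F] [Fintype κ] [DecidableEq κ]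
    (P : Matrix κ ρ F) (m : κ → F) (s : κ) :
    Matrix.vecMul m (sysGen P) (Sum.inl s) = m s := by
  simp [sysGen, Matrix.vecMul_fromCols]

theorem vecMul_sysGen_inr {F κ ρ : Type*} [Field F] [Fintype κ] [DecidableEq κ]
    (P : Matrix κ ρ F) (m : κ → F) (c : ρ) :
    Matrix.vecMul m (sysGen P) (Sum.inr c) = Matrix.vecMul m P c := by
  simp [sysGen, Matrix.vecMul_fromCols]

theorem vecMul_sysGen_injective {F κ ρ : Type*} [Field F] [Fintype κ] [DecidableEq κ]
    (P : Matrix κ ρ F) : Function.Injective fun m : κ → F => Matrix.vecMul m (sysGen P) := by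
  intro m m' h
  funext s
  simpa [vecMul_sysGen_inl] using congrFun h (Sum.inl s)

theorem minDist_sysGen_le {F κ ρ : Type*} [Field F] [Fintype κ] [DecidableEq κ] [Fintype ρ]
    [DecidableEq F] (P : Matrix κ ρ F) {m m' : κ → F} (hne : m ≠ m') :
    minDist (rowCode (sysGen P)) ≤
      hammingDist (Matrix.vecMul m (sysGen P)) (Matrix.vecMul m' (sysGen P)) := by
  refine Nat.sInf_le ⟨_, ⟨m, rfl⟩, _, ⟨m', rfl⟩, fun e => hne (vecMul_sysGen_injective P e), ?_⟩
  simp only [Matrix.vecMulLinear_apply]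
  congr!

/-- In an MDS code `[I P]`, any `k` symbols determine the message. -/
theorem IsScalarMDS.eq_of_agree {F κ ρ : Type*} [Field F] [Fintype κ] [DecidableEq κ] [Fintype ρ]
    {P : Matrix κ ρ F} {k : ℕ} (hP : IsScalarMDS (rowCode (sysGen P)) k)
    {R : Finset (κ ⊕ ρ)} (hR : k ≤ R.card) {m m' : κ → F}
    (h : ∀ x ∈ R, Matrix.vecMul m (sysGen P) x = Matrix.vecMul m' (sysGen P) x) : m = m' := by
  classical
  by_contra hne
  have hd := minDist_sysGen_le P hne
  have hsub : (Finset.univ.filter fun x => Matrix.vecMul m (sysGen P) x ≠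
      Matrix.vecMul m' (sysGen P) x) ⊆ Rᶜ := by
    intro x hx
    rw [Finset.mem_compl]
    exact fun hxR => (Finset.mem_filter.1 hx).2 (h x hxR)
  have hc := Finset.card_le_card hsub
  rw [Finset.card_compl] at hc
  have hle := Finset.card_le_univ R
  have h2 := hP.2
  unfold hammingDist at hd
  omega

/-- A systematic code without nonzero codewords of weight at most the number of parities is MDS. -/
theorem isScalarMDS_sysGen {F κ ρ : Type*} [Field F] [Fintype κ] [DecidableEq κ] [Nonempty κ]
    [Fintype ρ] (P : Matrix κ ρ F)
    (h : ∀ (m : κ → F) (S : Finset (κ ⊕ ρ)), S.card ≤ Fintype.card ρ →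
      (∀ x ∉ S, Matrix.vecMul m (sysGen P) x = 0) → m = 0) :
    IsScalarMDS (rowCode (sysGen P)) (Fintype.card κ) := by
  classical
  refine ⟨?_, ?_⟩
  · rw [rowCode, LinearMap.finrank_range_of_inj, Module.finrank_fintype_fun_eq_card]
    exact vecMul_sysGen_injective P
  · rw [Fintype.card_sum]
    suffices hmin : minDist (rowCode (sysGen P)) = Fintype.card ρ + 1 by omega
    have lower : ∀ m m' : κ → F, m ≠ m' → Fintype.card ρ + 1 ≤
        hammingDist (Matrix.vecMul m (sysGen P)) (Matrix.vecMul m' (sysGen P)) := by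
      intro m m' hne
      by_contra hlt
      -- By linearity, two close codewords give a codeword of small weight, supported where they
      -- differ.
      refine hne (sub_eq_zero.1 (h (m - m') (Finset.univ.filter fun x =>
        Matrix.vecMul m (sysGen P) x ≠ Matrix.vecMul m' (sysGen P) x) ?_ ?_))
      · unfold hammingDist at hlt
        omega
      · intro x hx
        simp only [Finset.mem_filter, Finset.mem_univ, true_and, not_not] at hx
        rw [Matrix.sub_vecMul, Pi.sub_apply, hx, sub_self]
    obtain ⟨s⟩ := ‹Nonempty κ›
    have hne : (Pi.single s 1 : κ → F) ≠ 0 := by simp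
    refine le_antisymm ?_ ?_
    · refine (minDist_sysGen_le P hne).trans ?_
      -- The codeword of a unit message is supported on one message position and the parities.
      refine (Finset.card_le_card (t := insert (Sum.inl s) (Finset.univ.image Sum.inr)) ?_).trans
        ((Finset.card_insert_le _ _).trans (Nat.succ_le_succ Finset.card_image_le))
      rintro (t | t) ht
      · simp only [vecMul_sysGen_inl, Matrix.zero_vecMul, Finset.mem_filter, Pi.zero_apply,
          ne_eq, Pi.single_apply] at ht
        simp at ht
        simp [ht]
      · simp
    · refine le_csInf ⟨_, _, ⟨Pi.single s 1, rfl⟩, _, ⟨0, rfl⟩,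
        fun e => hne (vecMul_sysGen_injective P e), rfl⟩ ?_
      rintro d ⟨_, ⟨m, rfl⟩, _, ⟨m', rfl⟩, hcc, rfl⟩
      refine (lower m m' fun e => hcc (by rw [e])).trans (le_of_eq ?_)
      simp only [Matrix.vecMulLinear_apply]

/-! ### Conversions determined by the sub-symbols that are read -/

/-- If the sub-symbols in `rd` of the initial codewords determine the parities of the final
codeword, then there is a conversion that keeps the message disks, reads exactly these
sub-symbols, and writes the parities. -/
theorem exists_conversion {F L κ ρ σ : Type*} [Nonempty F] {α : ℕ}
    (CI : VectorCode F κ (κ ⊕ ρ) α) (CF : VectorCode F (L × κ) ((L × κ) ⊕ σ) α)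
    (hI : ∀ m s, CI.encode m (Sum.inl s) = m s) (hF : ∀ m s, CF.encode m (Sum.inl s) = m s)
    (rd : L × (κ ⊕ ρ) → Finset (Fin α))
    (hrd : ∀ M M' : L × κ → Fin α → F,
      (∀ x, ∀ j ∈ rd x, CI.encode (fun i => M (x.1, i)) x.2 j =
        CI.encode (fun i => M' (x.1, i)) x.2 j) →
      ∀ i, CF.encode M (Sum.inr i) = CF.encode M' (Sum.inr i)) :
    ∃ T : Conversion CI CF,
      (∀ l s, T.origin (Sum.inl (l, s)) = some (l, Sum.inl s)) ∧
      (∀ i, T.origin (Sum.inr i) = none) ∧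
      (∀ x, T.ReadsExactly x (rd x)) ∧ (∀ x, T.readCount x = (rd x).card) ∧
      ∀ s, T.writeCount s = α := by
  classical
  let reads : (L × κ → Fin α → F) → ∀ x, Fin (rd x).card → F := fun M x t =>
    CI.encode (fun i => M (x.1, i)) x.2 ((rd x).equivFin.symm t)
  refine ⟨{
    origin := Sum.elim (fun x => some (x.1, Sum.inl x.2)) fun _ => none
    origin_inj := ?_
    unchanged := ?_
    readCount := fun x => (rd x).card
    read := fun x v t => v ((rd x).equivFin.symm t)
    writeCount := fun _ => α
    -- Any message consistent with the reads will do, because `hrd` makes the parities independent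
    -- of the choice. Inputs that no message produces are irrelevant.
    send := fun s y => if h : ∃ M, reads M = y then CF.encode h.choose s else
      fun _ => Classical.arbitrary F
    store := fun _ v => v
    correct := ?_ }, fun _ _ => rfl, fun _ => rfl, fun x => ⟨(rd x).equivFin.symm, fun _ _ => rfl⟩,
    fun _ => rfl, fun _ => rfl⟩
  · rintro (⟨l, s⟩ | s) (⟨l', s'⟩ | s') x <;> simp
    rintro rfl h
    simp at h
    simp [h]
  · rintro (⟨l, s⟩ | s) x h M
    · simp only [Sum.elim_inl, Option.some.injEq] at h
      subst h
      rw [hF, hI]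
    · simp at h
  · rintro (s | s) h M
    · simp at h
    · have hex : ∃ M', reads M' = reads M := ⟨M, rfl⟩
      change (if h : ∃ M', reads M' = reads M then CF.encode h.choose (Sum.inr s) else
        fun _ => Classical.arbitrary F) = _
      rw [dif_pos hex]
      refine hrd _ _ (fun x j hj => ?_) s
      have := congrFun (congrFun hex.choose_spec x) ((rd x).equivFin ⟨j, hj⟩)
      simpa [reads] using this

/-! ### Counting in MDS vector codes -/

/-- Restriction to `card κ` code symbols is an injection between finite sets of equal size, hence a
bijection. This replaces linear algebra for arbitrary encoders. -/
theorem VectorCode.IsMDS.exists_encode_eq {F κ ν : Type*} [Fintype F] [Fintype κ] [Fintype ν]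
    {α : ℕ} {C : VectorCode F κ ν α} (hC : C.IsMDS) (hκ : Fintype.card κ ≤ Fintype.card ν)
    {R : Finset ν} (hR : R.card ≤ Fintype.card κ) (v : ν → Fin α → F) :
    ∃ m, ∀ i ∈ R, C.encode m i = v i := by
  classical
  obtain ⟨R', hRR', -, hR'⟩ := Finset.exists_subsuperset_card_eq (Finset.subset_univ R) hR
    (by rwa [Finset.card_univ])
  have hinj : Function.Injective fun (m : κ → Fin α → F) (i : R') => C.encode m i := by
    intro m m' h
    exact hC R' hR' m m' fun i hi => congrFun h ⟨i, hi⟩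
  have hcard : Fintype.card (κ → Fin α → F) = Fintype.card (R' → Fin α → F) := by
    simp [hR']
  obtain ⟨m, hm⟩ := ((Fintype.bijective_iff_injective_and_card _).2 ⟨hinj, hcard⟩).2 fun i => v i
  exact ⟨m, fun i hi => congrFun hm ⟨i, hRR' hi⟩⟩

theorem VectorCode.IsMDS.eq_of_agree {F κ ν : Type*} [Fintype κ] {α : ℕ} {C : VectorCode F κ ν α}
    (hC : C.IsMDS) {R : Finset ν} (hR : Fintype.card κ ≤ R.card) {m m' : κ → Fin α → F}
    (h : ∀ i ∈ R, C.encode m i = C.encode m' i) : m = m' := by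
  obtain ⟨R', hRR', hR'⟩ := Finset.exists_subset_card_eq hR
  exact hC R' hR' m m' fun i hi => h i (hRR' hi)

/-- Allows each disk to be observed only up to an equivalence: equality if its whole symbol is
known, the kernel of `read` if only its transmission is. -/
theorem card_le_prod_card_quotient {X ι A : Type*} [Finite A] [Fintype ι] (e : X → ι → A)
    (r : ι → Setoid A) (h : ∀ x y, (∀ i, r i (e x i) (e y i)) → x = y) :
    Nat.card X ≤ ∏ i, Nat.card (Quotient (r i)) := by
  rw [← Nat.card_pi]
  refine Nat.card_le_card_of_injective
    (fun x i => (Quotient.mk (r i) (e x i) : Quotient (r i))) fun x y hxy => h x y fun i => ?_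
  exact Quotient.exact (congrFun hxy i)

theorem card_quotient_ker_le {F : Type*} [Fintype F] {α d : ℕ}
    (f : (Fin α → F) → (Fin d → F)) :
    Nat.card (Quotient (Setoid.ker f)) ≤ Fintype.card F ^ min d α := by
  rcases le_total d α with hd | hd
  · rw [min_eq_left hd]
    refine (Nat.card_le_card_of_injective _ (Setoid.kerLift_injective f)).trans (le_of_eq ?_)
    simp
  · rw [min_eq_right hd]
    refine (Nat.card_le_card_of_surjective _ (Quotient.mk_surjective (s := Setoid.ker f))).trans
      (le_of_eq ?_)
    simp

theorem card_quotient_bot {F : Type*} [Fintype F] {α : ℕ} :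
    Nat.card (Quotient (⊥ : Setoid (Fin α → F))) ≤ Fintype.card F ^ α := by
  refine (Nat.card_le_card_of_surjective _
    (Quotient.mk_surjective (s := (⊥ : Setoid (Fin α → F))))).trans (le_of_eq ?_)
  simp

/-! ### The lower bound on the bandwidth -/

namespace Conversion

open Classical in
/-- The initial disks of the `l`-th codeword that are kept unchanged. -/
noncomputable def kept {F L κ ι ν : Type*} [Fintype ι] {α : ℕ} {CI : VectorCode F κ ι α}
    {CF : VectorCode F (L × κ) ν α} (T : Conversion CI CF) (l : L) : Finset ι :=
  Finset.univ.filter fun x => ∃ s, T.origin s = some (l, x)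

theorem mem_kept {F L κ ι ν : Type*} [Fintype ι] {α : ℕ} {CI : VectorCode F κ ι α}
    {CF : VectorCode F (L × κ) ν α} {T : Conversion CI CF} {l : L} {x : ι} :
    x ∈ T.kept l ↔ ∃ s, T.origin s = some (l, x) := by
  simp [kept]

variable {F L κ ι ν : Type*} {α : ℕ} {CI : VectorCode F κ ι α} {CF : VectorCode F (L × κ) ν α}

/-- At most `k` disks of each initial codeword are kept. -/
theorem card_kept_le [Fintype F] [Nontrivial F] [Fintype L] [Fintype κ] [Fintype ι] [Fintype ν]
    (T : Conversion CI CF) (hCF : CF.IsMDS) (hα : 0 < α)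
    (hκ : Fintype.card κ < Fintype.card (L × κ))
    (hν : Fintype.card (L × κ) ≤ Fintype.card ν) (l : L) :
    (T.kept l).card ≤ Fintype.card κ := by
  classical
  by_contra! hlt
  obtain ⟨V, hV, hVc⟩ := Finset.exists_subset_card_eq (Nat.succ_le_of_lt hlt)
  have hpos : ∀ x : V, ∃ s, T.origin s = some (l, (x : ι)) := fun x => mem_kept.1 (hV x.2)
  choose pos hpos using hpos
  have hposinj : Function.Injective pos := by
    intro x y hxy
    have := (hpos x).symm.trans ((congrArg T.origin hxy).trans (hpos y))
    simp only [Option.some.injEq, Prod.mk.injEq, true_and] at this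
    exact Subtype.ext this
  -- In the final code any `card κ + 1` symbols take all values, and the kept disks hold these same
  -- symbols; but one initial codeword has too few messages for that.
  have hsurj : Function.Surjective fun (m : κ → Fin α → F) (x : V) => CI.encode m x := by
    intro v
    obtain ⟨M, hM⟩ := hCF.exists_encode_eq hν (R := Finset.univ.image pos)
      (Finset.card_image_le.trans (by simp only [Finset.card_univ, Fintype.card_coe]; omega))
      (fun s => if h : ∃ x, pos x = s then v h.choose else fun _ => Classical.arbitrary F)
    refine ⟨fun i => M (l, i), funext fun x => ?_⟩
    have h1 := hM (pos x) (Finset.mem_image_of_mem _ (Finset.mem_univ x))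
    have hex : ∃ y, pos y = pos x := ⟨x, rfl⟩
    rw [dif_pos hex, hposinj hex.choose_spec, T.unchanged _ _ (hpos x)] at h1
    exact h1
  have hc := Fintype.card_le_of_surjective _ hsurj
  simp only [Fintype.card_fun, Fintype.card_fin, Fintype.card_coe, hVc, ← pow_mul] at hc
  have := (Nat.pow_le_pow_iff_right (Fintype.one_lt_card (α := F))).1 hc
  nlinarith

/-- Each new disk receives at least `α` symbols. -/
theorem le_writeCount [Fintype F] [Nontrivial F] [Fintype L] [Fintype κ] [Fintype ν]
    (T : Conversion CI CF) (hCF : CF.IsMDS) (hκ : 0 < Fintype.card (L × κ))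
    (hν : Fintype.card (L × κ) ≤ Fintype.card ν) {s : ν} (hs : T.origin s = none) :
    α ≤ T.writeCount s := by
  have hsurj : Function.Surjective (T.store s) := by
    intro v
    obtain ⟨M, hM⟩ := hCF.exists_encode_eq hν (R := {s}) (by rwa [Finset.card_singleton]) fun _ => v
    exact ⟨_, (T.correct s hs M).trans (hM s (Finset.mem_singleton_self s))⟩
  have hc := Fintype.card_le_of_surjective _ hsurj
  simp only [Fintype.card_fun, Fintype.card_fin] at hc
  exact (Nat.pow_le_pow_iff_right (Fintype.one_lt_card (α := F))).1 hc

/-- A final disk is either new or, by injectivity of `origin`, charged to a kept initial disk of its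
own. -/
theorem le_card_new_add [Fintype L] [Fintype ι] [Fintype ν] (T : Conversion CI CF) :
    Fintype.card ν ≤ (Finset.univ.filter fun s => (T.origin s).isNone).card +
      ∑ l, (T.kept l).card := by
  classical
  rw [← Finset.card_univ, ← Finset.card_filter_add_card_filter_not
    (s := (Finset.univ : Finset ν)) fun s => (T.origin s).isNone]
  refine Nat.add_le_add_left ?_ _
  rw [← Finset.card_sigma]
  refine Finset.card_le_card_of_forall_subsingleton
    (fun s y => T.origin s = some (y.1, y.2)) (fun s hs => ?_) ?_
  · rcases ho : T.origin s with _ | ⟨l, x⟩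
    · simp [ho] at hs
    · exact ⟨⟨l, x⟩, Finset.mem_sigma.2 ⟨Finset.mem_univ l, mem_kept.2 ⟨s, ho⟩⟩, rfl⟩
  · intro y _ s hs t ht
    exact T.origin_inj s t _ hs.2 ht.2

/-- The symbols of the kept disks outside `S` and what is read from the other disks of the `l`-th
initial codeword determine its message. -/
theorem message_le_read [Fintype F] [Nontrivial F] [Fintype L] [Fintype κ] [Fintype ι] [Fintype ν]
    [DecidableEq ι] (T : Conversion CI CF) (hCF : CF.IsMDS) (l : L) {S : Finset ι} (hS : S ⊆ T.kept l)
    (hSc : S.card + Fintype.card (L × κ) ≤ Fintype.card ν) :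
    Fintype.card κ * α ≤ α * ((T.kept l).card - S.card) + ∑ x ∈ S, min (T.readCount (l, x)) α +
      ∑ x ∈ (T.kept l)ᶜ, min (T.readCount (l, x)) α := by
  classical
  -- Kept disks outside `S` are known completely, all others only through what they send.
  let r : ι → Setoid (Fin α → F) := fun x =>
    if x ∈ T.kept l \ S then ⊥ else Setoid.ker (T.read (l, x))
  let c : ι → ℕ := fun x => if x ∈ T.kept l \ S then α else min (T.readCount (l, x)) α
  -- Dropping the final disks that come from `S` still leaves enough symbols to decode.
  let R : Finset ν := Finset.univ.filter fun s => ∀ x ∈ S, T.origin s ≠ some (l, x)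
  have hR : Fintype.card (L × κ) ≤ R.card := by
    have : Rᶜ.card ≤ S.card := by
      refine Finset.card_le_card_of_forall_subsingleton
        (fun s x => T.origin s = some (l, x)) (fun s hs => ?_) ?_
      · simpa [R] using hs
      · intro x hx s hs t ht
        exact T.origin_inj s t _ hs.2 ht.2
    rw [Finset.card_compl] at this
    omega
  have hinj : ∀ m m' : κ → Fin α → F,
      (∀ x, r x (CI.encode m x) (CI.encode m' x)) → m = m' := by
    intro m m' h
    have hread : ∀ x, T.read (l, x) (CI.encode m x) = T.read (l, x) (CI.encode m' x) := by
      intro x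
      have hx := h x
      by_cases hxS : x ∈ T.kept l \ S
      · rw [show r x = ⊥ from if_pos hxS] at hx
        rw [show CI.encode m x = CI.encode m' x from hx]
      · rw [show r x = Setoid.ker _ from if_neg hxS] at hx
        exact hx
    -- The messages of the other codewords are frozen at an arbitrary value.
    let M : (κ → Fin α → F) → L × κ → Fin α → F := fun m p =>
      if p.1 = l then m p.2 else fun _ => Classical.arbitrary F
    have hMl : ∀ m, (fun i => M m (l, i)) = m := fun m => by simp [M]
    have hMne : ∀ l', l' ≠ l → (fun i => M m (l', i)) = fun i => M m' (l', i) := by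
      intro l' hl'
      simp [M, hl']
    have hMM : M m = M m' := by
      refine hCF.eq_of_agree hR fun s hs => ?_
      rcases ho : T.origin s with _ | ⟨l', x⟩
      · rw [← T.correct s ho, ← T.correct s ho]
        congr 2
        funext ⟨l', x⟩
        by_cases hl' : l' = l
        · subst hl'
          simp only [hMl, hread]
        · simp only [hMne l' hl']
      · rw [T.unchanged s _ ho, T.unchanged s _ ho]
        by_cases hl' : l' = l
        · subst hl'
          simp only [hMl]
          have hxS : x ∈ T.kept l' \ S := by
            refine Finset.mem_sdiff.2 ⟨mem_kept.2 ⟨s, ho⟩, fun hxS => ?_⟩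
            exact (Finset.mem_filter.1 hs).2 x hxS ho
          have hx := h x
          rw [show r x = ⊥ from if_pos hxS] at hx
          exact hx
        · simp only [hMne l' hl']
    rw [← hMl m, hMM, hMl]
  have hcard : Fintype.card F ^ (Fintype.card κ * α) ≤ Fintype.card F ^ ∑ x, c x := by
    have h1 := card_le_prod_card_quotient (fun (m : κ → Fin α → F) x => CI.encode m x) r hinj
    rw [Nat.card_eq_fintype_card, Fintype.card_fun, Fintype.card_fun, Fintype.card_fin,
      ← pow_mul, mul_comm] at h1
    rw [← Finset.prod_pow_eq_pow_sum]
    refine h1.trans (Finset.prod_le_prod' fun x _ => ?_)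
    by_cases hxS : x ∈ T.kept l \ S
    · simp only [r, c, if_pos hxS]
      exact card_quotient_bot
    · simp only [r, c, if_neg hxS]
      exact card_quotient_ker_le _
  have hle := (Nat.pow_le_pow_iff_right (Fintype.one_lt_card (α := F))).1 hcard
  refine hle.trans (le_of_eq ?_)
  rw [← Finset.sum_add_sum_compl (T.kept l)]
  congr 1
  · rw [← Finset.sum_sdiff hS]
    congr 1
    · rw [Finset.sum_congr rfl fun x hx => if_pos hx, Finset.sum_const,
        Finset.card_sdiff_of_subset hS, smul_eq_mul, mul_comm]
    · exact Finset.sum_congr rfl fun x hx => if_neg fun h => (Finset.mem_sdiff.1 h).2 hx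
  · refine Finset.sum_congr rfl fun x hx => if_neg fun h => ?_
    exact Finset.mem_compl.1 hx (Finset.mem_sdiff.1 h).1

end Conversion

/-- Among the subsets with `n` elements there is one on which a function is at most average. -/
theorem exists_subset_card_mul_sum_le {ι : Type*} (d : ι → ℕ) (V : Finset ι) {n : ℕ}
    (hn : n ≤ V.card) :
    ∃ S ⊆ V, S.card = n ∧ V.card * ∑ x ∈ S, d x ≤ n * ∑ x ∈ V, d x := by
  classical
  induction hu : V.card generalizing V with
  | zero => exact ⟨∅, by simp, by simp; omega, by simp⟩
  | succ u ih =>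
    rcases Nat.lt_or_ge u n with h | h
    · exact ⟨V, subset_rfl, by omega, by rw [show n = u + 1 by omega]⟩
    -- Discarding a largest value does not raise the average.
    · obtain ⟨x, hx, hmax⟩ := V.exists_max_image d (Finset.card_pos.1 (by omega))
      have hc : (V.erase x).card = u := by rw [Finset.card_erase_of_mem hx]; omega
      obtain ⟨S, hSV, hSn, hS⟩ := ih (V.erase x) (by omega) hc
      refine ⟨S, hSV.trans (Finset.erase_subset _ _), hSn, ?_⟩
      have h1 := Finset.add_sum_erase V d hx
      have h2 : ∑ y ∈ V.erase x, d y ≤ u * d x := by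
        rw [← hc, ← smul_eq_mul]
        exact Finset.sum_le_card_nsmul _ _ _ fun y hy => hmax y (Finset.mem_of_mem_erase hy)
      have h3 : ∑ y ∈ S, d y ≤ n * d x := by
        rw [← hSn, ← smul_eq_mul]
        exact Finset.sum_le_card_nsmul _ _ _ fun y hy =>
          hmax y (Finset.mem_of_mem_erase (hSV hy))
      rw [← h1]
      nlinarith

namespace Conversion

/-- The contribution of an initial codeword to the bandwidth, in units of `1 / r`. -/
theorem read_add_write_lower_bound {F L κ ι ν : Type*} {α : ℕ} {CI : VectorCode F κ ι α}
    {CF : VectorCode F (L × κ) ν α} [Fintype F] [Nontrivial F] [Fintype L] [Fintype κ] [Fintype ι]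
    [Fintype ν] (T : Conversion CI CF) (hCF : CF.IsMDS) (l : L) {rI r : ℕ}
    (hι : Fintype.card ι = Fintype.card κ + rI)
    (hν : Fintype.card ν = Fintype.card (L × κ) + r) (hr : rI ≤ r) (hrk : r ≤ Fintype.card κ)
    (hu : (T.kept l).card ≤ Fintype.card κ) :
    (r * α * (Fintype.card κ + rI) : ℤ) ≤ r * ∑ x, (T.readCount (l, x) : ℤ) +
      r * α * (Fintype.card κ - (T.kept l).card) + α * rI * Fintype.card κ := by
  classical
  set d : ι → ℕ := fun x => min (T.readCount (l, x)) α
  set k := Fintype.card κ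
  set u := (T.kept l).card with hudef
  have hsum : ∑ x ∈ T.kept l, d x + ∑ x ∈ (T.kept l)ᶜ, d x ≤ ∑ x, T.readCount (l, x) := by
    rw [Finset.sum_add_sum_compl]
    exact Finset.sum_le_sum fun x _ => min_le_left _ _
  have hB : ∑ x ∈ (T.kept l)ᶜ, d x ≤ (k + rI - u) * α := by
    rw [← hι, hudef, ← Finset.card_compl, ← smul_eq_mul]
    exact Finset.sum_le_card_nsmul _ _ _ fun x _ => min_le_right _ _
  have hsumZ : ((∑ x ∈ T.kept l, d x : ℕ) : ℤ) + (∑ x ∈ (T.kept l)ᶜ, d x : ℕ) ≤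
      ∑ x, (T.readCount (l, x) : ℤ) := by exact_mod_cast hsum
  have huk : u ≤ k := hu
  have hBZ : ((∑ x ∈ (T.kept l)ᶜ, d x : ℕ) : ℤ) ≤ (k + rI - u) * α := by
    have := (Int.ofNat_le.2 hB)
    rwa [Int.natCast_mul, Nat.cast_sub (by omega), Nat.cast_add] at this
  have huk' : (u : ℤ) ≤ k := by exact_mod_cast huk
  have hr' : (rI : ℤ) ≤ r := by exact_mod_cast hr
  have hrk' : (r : ℤ) ≤ k := by exact_mod_cast hrk
  have hα : (0 : ℤ) ≤ α := Int.natCast_nonneg α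
  rcases Nat.lt_or_ge u r with hur | hur
  -- With fewer than `r` disks kept, `S` can be all of them, so the whole message has to be read.
  · have h1 := T.message_le_read hCF l subset_rfl (by rw [hν]; omega)
    rw [Nat.sub_self, Nat.mul_zero, Nat.zero_add] at h1
    have h2 : (k * α : ℤ) ≤ ∑ x, (T.readCount (l, x) : ℤ) := by exact_mod_cast h1.trans hsum
    have h3 := mul_le_mul_of_nonneg_left h2 (Int.natCast_nonneg r)
    have h4 : (0 : ℤ) ≤ α * (r * (k - u) + rI * (k - r)) := by
      have := mul_nonneg (Int.natCast_nonneg r) (sub_nonneg.2 huk')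
      have := mul_nonneg (Int.natCast_nonneg rI) (sub_nonneg.2 hrk')
      positivity
    linarith
  · obtain ⟨S, hS, hSc, havg⟩ := exists_subset_card_mul_sum_le d (T.kept l) hur
    have h1 := T.message_le_read hCF l hS (by omega)
    rw [hSc] at h1
    have h2 : (k * α : ℤ) ≤ α * (u - r) + (∑ x ∈ S, d x : ℕ) + (∑ x ∈ (T.kept l)ᶜ, d x : ℕ) := by
      have := Int.ofNat_le.2 h1
      rwa [Int.natCast_add, Int.natCast_add, Int.natCast_mul, Int.natCast_mul,
        Nat.cast_sub hur] at this
    have havgZ : (u * (∑ x ∈ S, d x : ℕ) : ℤ) ≤ r * (∑ x ∈ T.kept l, d x : ℕ) := by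
      exact_mod_cast havg
    have hur' : (r : ℤ) ≤ u := by exact_mod_cast hur
    have h3 := mul_le_mul_of_nonneg_left h2 (Int.natCast_nonneg u)
    have h4 := mul_le_mul_of_nonneg_left hBZ (sub_nonneg.2 hur')
    have h5 := mul_le_mul_of_nonneg_left hsumZ (Int.natCast_nonneg r)
    -- The slack of the estimate; it vanishes when `u = k`.
    have h6 : (0 : ℤ) ≤ α * (k - u) * (r + rI) := by
      have := sub_nonneg.2 huk'
      positivity
    linarith

/-- The lower bound on the bandwidth of any conversion to an MDS code, in units of `1 / r`. -/
theorem bandwidth_lower_bound {F L κ ι ν : Type*} {α : ℕ} {CI : VectorCode F κ ι α}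
    {CF : VectorCode F (L × κ) ν α} [Fintype F] [Nontrivial F] [Fintype L] [Fintype κ] [Fintype ι]
    [Fintype ν] (T : Conversion CI CF) (hCF : CF.IsMDS) {rI r : ℕ}
    (hι : Fintype.card ι = Fintype.card κ + rI)
    (hν : Fintype.card ν = Fintype.card (L × κ) + r) (hr : rI ≤ r) (hrk : r ≤ Fintype.card κ)
    (hα : 0 < α) (hL : 2 ≤ Fintype.card L) (hκ : 0 < Fintype.card κ) :
    Fintype.card L * (r * α * (Fintype.card κ + rI)) + r * (r * α) ≤
      r * T.bandwidth + Fintype.card L * (α * rI * Fintype.card κ) := by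
  classical
  have hLκ : Fintype.card κ < Fintype.card (L × κ) := by
    rw [Fintype.card_prod]
    nlinarith
  have hread := Finset.sum_le_sum fun l (_ : l ∈ Finset.univ) =>
    T.read_add_write_lower_bound hCF l hι hν hr hrk (T.card_kept_le hCF hα hLκ (by omega) l)
  simp only [Finset.sum_add_distrib, ← Finset.mul_sum, Finset.sum_sub_distrib, Finset.sum_const,
    Finset.card_univ, nsmul_eq_mul] at hread
  have hwrite : (Finset.univ.filter fun s => (T.origin s).isNone).card * α ≤
      T.writeBandwidth := by
    rw [← smul_eq_mul]
    refine Finset.card_nsmul_le_sum _ _ _ fun s hs => ?_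
    exact T.le_writeCount hCF (by omega) (by omega)
      (Option.isNone_iff_eq_none.1 (Finset.mem_filter.1 hs).2)
  have hnew := T.le_card_new_add
  rw [hν, Fintype.card_prod] at hnew
  have hrb : T.readBandwidth = ∑ l, ∑ x, T.readCount (l, x) := Fintype.sum_prod_type _
  rw [bandwidth]
  have h1 := Nat.mul_le_mul_right α hnew
  -- The forced writes beyond `r * α` pay for the terms `r * α * (k - u)` in the sum of the read
  -- bounds.
  have h2 : (r : ℤ) * ((Fintype.card L * Fintype.card κ + r) * α) ≤
      r * (T.writeBandwidth + (∑ l, ((T.kept l).card : ℤ)) * α) := by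
    refine mul_le_mul_of_nonneg_left ?_ (Int.natCast_nonneg r)
    have : (Fintype.card L * Fintype.card κ + r) * α ≤
      T.writeBandwidth + (∑ l, (T.kept l).card) * α := h1.trans (by rw [add_mul]; omega)
    exact_mod_cast this
  have h3 : (T.readBandwidth : ℤ) = ∑ l, ∑ x, (T.readCount (l, x) : ℤ) := by
    exact_mod_cast hrb
  zify
  rw [← h3] at hread
  nlinarith

end Conversion

/-! ### Codes formed by independent instances -/

theorem VectorCode.instances_isLinear {F κ ν : Type*} [Field F] [Fintype κ] (G : Matrix κ ν F)
    (α : ℕ) : (VectorCode.instances G α).IsLinear where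
  map_add m m' := by
    funext i j
    exact congrFun (Matrix.add_vecMul (A := G) (x := fun s => m s j) (y := fun s => m' s j)) i
  map_smul a m := by
    funext i j
    exact congrFun (Matrix.smul_vecMul a (fun s => m s j) G) i

theorem IsScalarMDS.instances_isMDS {F κ ρ : Type*} [Field F] [Fintype κ] [DecidableEq κ]
    [Fintype ρ] {P : Matrix κ ρ F} (hP : IsScalarMDS (rowCode (sysGen P)) (Fintype.card κ))
    (α : ℕ) : (VectorCode.instances (sysGen P) α).IsMDS := by
  intro R hR m m' h
  funext s j
  exact congrFun (hP.eq_of_agree hR.ge (m := fun s => m s j) (m' := fun s => m' s j)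
    fun x hx => congrFun (h x hx) j) s

/-! ### The piggybacked code -/

theorem piggybackCode_encode_inr_of_lt {F : Type*} [Field F] {k rI rF : ℕ} (h : rI < rF)
    (PI : Matrix (Fin k) (Fin rF) F) (m : Fin k → Fin (subPack rI rF) → F) (i : Fin rI)
    (j : Fin (subPack rI rF)) (hj : (j : ℕ) < subPackFree rI rF) :
    (piggybackCode h PI).encode m (Sum.inr i) j =
      Matrix.vecMul (fun s => m s j) PI (Fin.castLE h.le i) := by
  simp [piggybackCode, hj.not_ge]

theorem piggybackCode_encode_inr_of_le {F : Type*} [Field F] {k rI rF : ℕ} (h : rI < rF)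
    (PI : Matrix (Fin k) (Fin rF) F) (m : Fin k → Fin (subPack rI rF) → F) (i : Fin rI)
    (j : Fin (subPack rI rF)) (hj : subPackFree rI rF ≤ j) (a : Fin (subPack rI rF)) (c : Fin rF)
    (ha : (a : ℕ) = i / Nat.gcd rF rI)
    (hc : (c : ℕ) = rI + (subPack rI rF - subPackFree rI rF) * (i % Nat.gcd rF rI) +
      (j - subPackFree rI rF)) :
    (piggybackCode h PI).encode m (Sum.inr i) j =
      Matrix.vecMul (fun s => m s j) PI (Fin.castLE h.le i) +
        Matrix.vecMul (fun s => m s a) PI c := by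
  obtain rfl : a = ⟨i / Nat.gcd rF rI, piggyback_instance_lt h i⟩ := Fin.ext ha
  obtain rfl : c = ⟨_, piggyback_column_lt h i j hj⟩ := Fin.ext hc
  simp [piggybackCode, hj]

theorem piggybackCode_isLinear {F : Type*} [Field F] {k rI rF : ℕ} (h : rI < rF)
    (PI : Matrix (Fin k) (Fin rF) F) : (piggybackCode h PI).IsLinear := by
  have hadd : ∀ (m m' : Fin k → Fin (subPack rI rF) → F) j c,
      Matrix.vecMul (fun s => (m + m') s j) PI c =
        Matrix.vecMul (fun s => m s j) PI c + Matrix.vecMul (fun s => m' s j) PI c :=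
    fun m m' j c => congrFun (Matrix.add_vecMul (A := PI) (x := fun s => m s j)
      (y := fun s => m' s j)) c
  have hsmul : ∀ (a : F) (m : Fin k → Fin (subPack rI rF) → F) j c,
      Matrix.vecMul (fun s => (a • m) s j) PI c = a * Matrix.vecMul (fun s => m s j) PI c :=
    fun a m j c => congrFun (Matrix.smul_vecMul a (fun s => m s j) PI) c
  constructor
  · intro m m'
    funext x j
    rcases x with s | i
    · rfl
    rw [Pi.add_apply, Pi.add_apply]
    by_cases hj : subPackFree rI rF ≤ (j : ℕ)
    · simp only [piggybackCode_encode_inr_of_le h PI _ i j hj ⟨_, piggyback_instance_lt h i⟩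
        ⟨_, piggyback_column_lt h i j hj⟩ rfl rfl, hadd]
      ring
    · simp only [piggybackCode_encode_inr_of_lt h PI _ i j (not_le.1 hj), hadd]
  · intro a m
    funext x j
    rcases x with s | i
    · rfl
    rw [Pi.smul_apply, Pi.smul_apply, smul_eq_mul]
    by_cases hj : subPackFree rI rF ≤ (j : ℕ)
    · simp only [piggybackCode_encode_inr_of_le h PI _ i j hj ⟨_, piggyback_instance_lt h i⟩
        ⟨_, piggyback_column_lt h i j hj⟩ rfl rfl, hsmul]
      ring
    · simp only [piggybackCode_encode_inr_of_lt h PI _ i j (not_le.1 hj), hsmul]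

theorem subPack_mul_gcd (rI rF : ℕ) : subPack rI rF * Nat.gcd rF rI = rF :=
  Nat.div_mul_cancel (Nat.gcd_dvd_left rF rI)

theorem subPackFree_mul_gcd (rI rF : ℕ) : subPackFree rI rF * Nat.gcd rF rI = rI :=
  Nat.div_mul_cancel (Nat.gcd_dvd_right rF rI)

theorem subPackFree_lt_subPack {rI rF : ℕ} (h : rI < rF) : subPackFree rI rF < subPack rI rF := by
  refine lt_of_mul_lt_mul_right (a := Nat.gcd rF rI) ?_ (Nat.zero_le _)
  rwa [subPack_mul_gcd, subPackFree_mul_gcd]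

theorem div_gcd_lt_subPackFree {rI : ℕ} (rF : ℕ) (i : Fin rI) :
    (i : ℕ) / Nat.gcd rF rI < subPackFree rI rF :=
  Nat.div_lt_div_of_lt_of_dvd (Nat.gcd_dvd_right rF rI) i.2

theorem piggybackCode_isMDS {F : Type*} [Field F] {k rI rF : ℕ} (h : rI < rF)
    {PI : Matrix (Fin k) (Fin rF) F} (hPI : IsScalarMDS (rowCode (sysGen PI)) k) :
    (piggybackCode h PI).IsMDS := by
  intro R hR m m' hagree
  -- Stripped of piggybacks, each instance is the base code punctured to its first `rI` parities,
  -- where `k` symbols still suffice.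
  let φ : Fin k ⊕ Fin rI ↪ Fin k ⊕ Fin rF :=
    (Function.Embedding.refl _).sumMap (Fin.castLEEmb h.le)
  have key : ∀ j, (∀ i, Sum.inr i ∈ R →
      Matrix.vecMul (fun s => m s j) PI (Fin.castLE h.le i) =
        Matrix.vecMul (fun s => m' s j) PI (Fin.castLE h.le i)) →
      (fun s => m s j) = fun s => m' s j := by
    intro j hj
    refine hPI.eq_of_agree (R := R.map φ) (by rw [Finset.card_map, hR, Fintype.card_fin]) ?_
    intro x hx
    obtain ⟨s | i, hy, rfl⟩ := Finset.mem_map.1 hx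
    · have : φ (Sum.inl s) = Sum.inl s := rfl
      rw [this, vecMul_sysGen_inl, vecMul_sysGen_inl]
      exact congrFun (hagree _ hy) j
    · have : φ (Sum.inr i) = Sum.inr (Fin.castLE h.le i) := rfl
      rw [this, vecMul_sysGen_inr, vecMul_sysGen_inr]
      exact hj i hy
  have low : ∀ j : Fin (subPack rI rF), (j : ℕ) < subPackFree rI rF →
      (fun s => m s j) = fun s => m' s j := by
    intro j hj
    refine key j fun i hi => ?_
    have := congrFun (hagree _ hi) j
    rwa [piggybackCode_encode_inr_of_lt h PI _ i j hj,
      piggybackCode_encode_inr_of_lt h PI _ i j hj] at this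
  funext s j
  refine congrFun (f := fun s => m s j) (g := fun s => m' s j) ?_ s
  by_cases hj : (j : ℕ) < subPackFree rI rF
  · exact low j hj
  · rw [not_lt] at hj
    refine key j fun i hi => ?_
    have := congrFun (hagree _ hi) j
    rw [piggybackCode_encode_inr_of_le h PI _ i j hj ⟨_, piggyback_instance_lt h i⟩
        ⟨_, piggyback_column_lt h i j hj⟩ rfl rfl,
      piggybackCode_encode_inr_of_le h PI _ i j hj ⟨_, piggyback_instance_lt h i⟩
        ⟨_, piggyback_column_lt h i j hj⟩ rfl rfl, low ⟨_, piggyback_instance_lt h i⟩ (div_gcd_lt_subPackFree rF i)] at this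
    exact add_right_cancel this

/-- The sub-symbols with index at least `β` of the message disks together with the parity disks
determine all parities of the base code. -/
theorem piggybackCode_base_parities_eq {F : Type*} [Field F] {k rI rF : ℕ} (h : rI < rF)
    (PI : Matrix (Fin k) (Fin rF) F) {m m' : Fin k → Fin (subPack rI rF) → F}
    (hmsg : ∀ s (j : Fin (subPack rI rF)), subPackFree rI rF ≤ j → m s j = m' s j)
    (hpar : ∀ i, (piggybackCode h PI).encode m (Sum.inr i) =
      (piggybackCode h PI).encode m' (Sum.inr i)) (j : Fin (subPack rI rF)) :
    Matrix.vecMul (fun s => m s j) PI = Matrix.vecMul (fun s => m' s j) PI := by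
  have high : ∀ j : Fin (subPack rI rF), subPackFree rI rF ≤ j →
      (fun s => m s j) = fun s => m' s j := fun j hj => funext fun s => hmsg s j hj
  by_cases hj : subPackFree rI rF ≤ (j : ℕ)
  · rw [high j hj]
  rw [not_le] at hj
  funext c
  by_cases hc : (c : ℕ) < rI
  · have := congrFun (hpar ⟨c, hc⟩) j
    rwa [piggybackCode_encode_inr_of_lt h PI _ _ j hj,
      piggybackCode_encode_inr_of_lt h PI _ _ j hj] at this
  rw [not_lt] at hc
  have hg : 0 < Nat.gcd rF rI := Nat.gcd_pos_of_pos_left _ (by omega)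
  have h1 := subPack_mul_gcd rI rF
  have h2 := subPackFree_mul_gcd rI rF
  have h3 := subPackFree_lt_subPack h
  set g := Nat.gcd rF rI with hgdef
  set δ := subPack rI rF - subPackFree rI rF with hδ
  have hδpos : 0 < δ := by omega
  have hδg : δ * g = rF - rI := by rw [hδ, Nat.sub_mul, h1, h2]
  -- Inverts the piggyback layout: column `c` of instance `j` sits on parity disk `j * g + (c - rI)
  -- / δ`, in sub-symbol `β + (c - rI) % δ`.
  have hi2 : (c - rI : ℕ) / δ < g := by
    rw [Nat.div_lt_iff_lt_mul hδpos, mul_comm, hδg]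
    have := c.2
    omega
  have ht : (c - rI : ℕ) % δ < δ := Nat.mod_lt _ hδpos
  have hi : j * g + (c - rI : ℕ) / δ < rI := by
    have : (j + 1) * g ≤ subPackFree rI rF * g := Nat.mul_le_mul_right g hj
    rw [add_mul, h2] at this
    omega
  have hj' : subPackFree rI rF + (c - rI : ℕ) % δ < subPack rI rF := by omega
  have ha : (j : ℕ) = (j * g + (c - rI : ℕ) / δ) / g := by
    rw [mul_comm, Nat.mul_add_div hg, Nat.div_eq_of_lt hi2, add_zero]
  have hc' : (c : ℕ) = rI + δ * ((j * g + (c - rI : ℕ) / δ) % g) +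
      (subPackFree rI rF + (c - rI : ℕ) % δ - subPackFree rI rF) := by
    rw [mul_comm (j : ℕ), Nat.mul_add_mod, Nat.mod_eq_of_lt hi2, Nat.add_sub_cancel_left,
      add_assoc, Nat.div_add_mod]
    omega
  have := congrFun (hpar ⟨_, hi⟩) ⟨_, hj'⟩
  rw [piggybackCode_encode_inr_of_le h PI _ _ _ (Nat.le_add_right _ _) j c ha hc',
    piggybackCode_encode_inr_of_le h PI _ _ _ (Nat.le_add_right _ _) j c ha hc',
    high _ (Nat.le_add_right _ _)] at this
  exact add_left_cancel this

/-! ### The conversion of the piggybacked code -/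

/-- The sub-symbols read from the initial disks: those with index at least `β` of the message
disks and all of the parity disks. -/
def piggybackReads (lam k rI rF : ℕ) : Fin lam × (Fin k ⊕ Fin rI) → Finset (Fin (subPack rI rF)) :=
  fun x => Sum.elim
    (fun _ => Finset.univ.filter fun j : Fin (subPack rI rF) => subPackFree rI rF ≤ (j : ℕ))
    (fun _ => Finset.univ) x.2

theorem sum_card_piggybackReads (lam k rI rF : ℕ) :
    ∑ x, (piggybackReads lam k rI rF x).card =
      lam * (k * (subPack rI rF - subPackFree rI rF) + rI * subPack rI rF) := by
  have hcard : (Finset.univ.filter fun j : Fin (subPack rI rF) =>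
      subPackFree rI rF ≤ (j : ℕ)).card = subPack rI rF - subPackFree rI rF := by
    rw [← Nat.card_Ico, ← Finset.card_map Fin.valEmbedding]
    congr 1
    ext j
    simp only [Finset.mem_map, Finset.mem_filter, Finset.mem_univ, true_and, Finset.mem_Ico,
      Fin.valEmbedding_apply]
    exact ⟨fun ⟨a, ha, e⟩ => e ▸ ⟨ha, a.2⟩, fun ⟨h1, h2⟩ => ⟨⟨j, h2⟩, h1, rfl⟩⟩
  simp [piggybackReads, Fintype.sum_prod_type, Fintype.sum_sum_type, hcard]

theorem exists_piggyback_conversion {F : Type*} [Field F] [Fintype F] {lam k rI rF : ℕ}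
    (hlam : 2 ≤ lam) (hr : rI < rF) (hk : rF < k)
    {PI : Matrix (Fin k) (Fin rF) F} {PF : Matrix (Fin lam × Fin k) (Fin rF) F}
    (h : ∃ h : (Fin lam → Fin rF → F) → Fin rF → F, ∀ M : Fin lam × Fin k → F,
      Matrix.vecMul M PF = h (fun l => Matrix.vecMul (fun s => M (l, s)) PI)) :
    ∃ T : Conversion (piggybackCode hr PI) (VectorCode.instances (sysGen PF) (subPack rI rF)),
      (∀ l s, T.origin (Sum.inl (l, s)) = some (l, Sum.inl s)) ∧
      (∀ i, T.origin (Sum.inr i) = none) ∧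
      (∀ l s, T.ReadsExactly (l, Sum.inl s)
        (Finset.univ.filter fun j => subPackFree rI rF ≤ (j : ℕ))) ∧
      (∀ l i, T.ReadsExactly (l, Sum.inr i) Finset.univ) ∧
      (T.readBandwidth : ℚ) = lam * subPack rI rF * (rI + (1 - (rI : ℚ) / rF) * k) ∧
      T.writeBandwidth = rF * subPack rI rF ∧
      T.IsBandwidthOptimal := by
  obtain ⟨h, hh⟩ := h
  obtain ⟨T, horig, hnew, hreads, hread, hwrite⟩ := exists_conversion
    (piggybackCode hr PI) (VectorCode.instances (sysGen PF) (subPack rI rF)) (fun _ _ => rfl)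
    (fun m s => funext fun j => vecMul_sysGen_inl PF (fun p => m p j) s)
    (piggybackReads lam k rI rF) (by
      intro M M' hMM' i
      funext j
      refine (vecMul_sysGen_inr PF (fun p => M p j) i).trans
        (Eq.trans ?_ (vecMul_sysGen_inr PF (fun p => M' p j) i).symm)
      rw [hh, hh]
      congr 2
      funext l
      refine piggybackCode_base_parities_eq hr PI (m := fun s => M (l, s))
        (m' := fun s => M' (l, s)) (fun s j' hj' => ?_) (fun i' => funext fun j' => ?_) j
      · exact hMM' (l, Sum.inl s) j' (by simp [piggybackReads, hj'])
      · exact hMM' (l, Sum.inr i') j' (by simp [piggybackReads]))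
  have hrb : T.readBandwidth =
      lam * (k * (subPack rI rF - subPackFree rI rF) + rI * subPack rI rF) := by
    rw [Conversion.readBandwidth, ← sum_card_piggybackReads]
    exact Finset.sum_congr rfl fun x _ => hread x
  have hwb : T.writeBandwidth = rF * subPack rI rF := by
    simp only [Conversion.writeBandwidth, hwrite, Finset.sum_filter, Fintype.sum_sum_type,
      Fintype.sum_prod_type, hnew, horig]
    simp
  have hβ := (subPackFree_lt_subPack hr).le
  have hαβ : subPack rI rF * rI = subPackFree rI rF * rF := by
    have h1 := subPack_mul_gcd rI rF
    have h2 := subPackFree_mul_gcd rI rF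
    calc subPack rI rF * rI = subPack rI rF * (subPackFree rI rF * Nat.gcd rF rI) := by rw [h2]
      _ = subPackFree rI rF * (subPack rI rF * Nat.gcd rF rI) := by ring
      _ = subPackFree rI rF * rF := by rw [h1]
  refine ⟨T, horig, hnew, fun l s => hreads (l, Sum.inl s), fun l i => hreads (l, Sum.inr i),
    ?_, hwb, ?_⟩
  · have hrF : (rF : ℚ) ≠ 0 := by
      have : rF ≠ 0 := by omega
      exact_mod_cast this
    have hq : (subPack rI rF : ℚ) * rI = subPackFree rI rF * rF := by exact_mod_cast hαβ
    rw [hrb]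
    push_cast [Nat.cast_sub hβ]
    field_simp
    linear_combination (k : ℚ) * hq
  · intro CI' CF' _ hCF' T'
    have hlow := T'.bandwidth_lower_bound (rI := rI) (r := rF) hCF' (by simp) (by simp) hr.le
      (by simpa using hk.le) ((Nat.zero_le _).trans_lt (subPackFree_lt_subPack hr)) (by simpa)
      (by simp; omega)
    -- Replacing `α * rI` by `β * rF` gives every term a factor `rF`, which then cancels to leave
    -- the exact cost.
    rw [Fintype.card_fin, Fintype.card_fin, hαβ] at hlow
    rw [Conversion.bandwidth, hrb, hwb]
    refine Nat.le_of_mul_le_mul_left ?_ ((Nat.zero_le _).trans_lt hr)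
    zify [hβ] at hlow ⊢
    linarith

/-- A systematic pair of MDS codes whose final parities are a function of the initial parities is
an access-optimal base pair. -/
theorem IsAccessOptimalBase.of_parity_computable {F : Type*} [Field F] {lam k r : ℕ}
    {PI : Matrix (Fin k) (Fin r) F} {PF : Matrix (Fin lam × Fin k) (Fin r) F}
    (hPI : IsScalarMDS (rowCode (sysGen PI)) k) (hPF : IsScalarMDS (rowCode (sysGen PF)) (lam * k))
    (h : ∀ M M' : Fin lam × Fin k → F,
      (∀ l, Matrix.vecMul (fun s => M (l, s)) PI = Matrix.vecMul (fun s => M' (l, s)) PI) →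
      Matrix.vecMul M PF = Matrix.vecMul M' PF) : IsAccessOptimalBase PI PF where
  initial_mds := hPI
  final_mds := hPF
  access_optimal := by
    obtain ⟨T, horig, hnew, -, hread, -⟩ := exists_conversion
      (VectorCode.instances (sysGen PI) 1) (VectorCode.instances (sysGen PF) 1)
      (fun m s => funext fun j => vecMul_sysGen_inl PI (fun p => m p j) s)
      (fun m s => funext fun j => vecMul_sysGen_inl PF (fun p => m p j) s)
      -- Nothing is read from message disks, so only the `lam * r` parity disks are accessed.
      (fun x => Sum.elim (fun _ => ∅) (fun _ => Finset.univ) x.2) (by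
        intro M M' hMM' i
        funext j
        refine (vecMul_sysGen_inr PF (fun p => M p j) i).trans
          (Eq.trans ?_ (vecMul_sysGen_inr PF (fun p => M' p j) i).symm)
        refine congrFun (h _ _ fun l => funext fun c => ?_) i
        have := hMM' (l, Sum.inr c) j (Finset.mem_univ j)
        exact (vecMul_sysGen_inr PI (fun s => M (l, s) j) c).symm.trans
          (this.trans (vecMul_sysGen_inr PI (fun s => M' (l, s) j) c)))
    refine ⟨T, ?_, ?_⟩
    · simp only [Conversion.readAccessCost, hread, Finset.card_filter, Fintype.sum_prod_type,
        Fintype.sum_sum_type]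
      simp
    · simp only [Conversion.writeAccessCost, Finset.card_filter, Fintype.sum_prod_type,
        Fintype.sum_sum_type, hnew, horig]
      simp
  parity_computable := by
    let y : (Fin lam × Fin k → F) → Fin lam → Fin r → F := fun M l =>
      Matrix.vecMul (fun s => M (l, s)) PI
    have hf : (fun M => Matrix.vecMul M PF).FactorsThrough y :=
      fun M M' hMM' => h M M' fun l => congrFun hMM' l
    exact ⟨Function.extend y (fun M => Matrix.vecMul M PF) 0, fun M =>
      (hf.extend_apply 0 M).symm⟩

/-! ### Base pairs from constacyclic codes -/

/-- Vandermonde independence: the relation extends to polynomials of degree below `r`, and one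
vanishing at every node except that of `z` isolates `c z`. -/
theorem eq_zero_of_sum_mul_pow_eq_zero {K ν : Type*} [Field K] {S : Finset ν} {y : ν → K}
    (hy : Set.InjOn y S) {c : ν → K} {r : ℕ} (hS : S.card ≤ r)
    (h : ∀ i < r, ∑ x ∈ S, c x * y x ^ i = 0) {z : ν} (hz : z ∈ S) : c z = 0 := by
  classical
  let p : Polynomial K := ∏ b ∈ S.erase z, (Polynomial.X - Polynomial.C (y b))
  have hdeg : p.natDegree < r := by
    rw [Polynomial.natDegree_prod_of_monic _ _ fun b _ => Polynomial.monic_X_sub_C _]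
    have := Finset.card_pos.2 ⟨z, hz⟩
    simp only [Polynomial.natDegree_X_sub_C, Finset.sum_const, smul_eq_mul, mul_one,
      Finset.card_erase_of_mem hz]
    omega
  have hp : ∑ x ∈ S, c x * p.eval (y x) = 0 := by
    simp only [Polynomial.eval_eq_sum_range' hdeg, Finset.mul_sum]
    rw [Finset.sum_comm]
    refine Finset.sum_eq_zero fun i hi => ?_
    rw [← mul_zero (p.coeff i), ← h i (Finset.mem_range.1 hi), Finset.mul_sum]
    exact Finset.sum_congr rfl fun x _ => by ring
  rw [Finset.sum_eq_single_of_mem z hz] at hp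
  · refine (mul_eq_zero.1 hp).resolve_right ?_
    rw [Polynomial.eval_prod]
    refine Finset.prod_ne_zero_iff.2 fun b hb => ?_
    rw [Polynomial.eval_sub, Polynomial.eval_X, Polynomial.eval_C, sub_ne_zero]
    exact fun e => Finset.ne_of_mem_erase hb (hy (Finset.mem_of_mem_erase hb) hz e.symm)
  · intro x hx hxz
    rw [Polynomial.eval_prod, Finset.prod_eq_zero (Finset.mem_erase.2 ⟨hxz, hx⟩) (by simp),
      mul_zero]

/-- The image of `F` already exhausts the at most `q` roots of `X ^ q - X`. -/
theorem exists_algebraMap_eq_of_pow_card_eq {F K : Type*} [Field F] [Fintype F] [Field K]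
    [Algebra F K] {x : K} (hx : x ^ Fintype.card F = x) : ∃ a, algebraMap F K a = x := by
  classical
  have hq := Fintype.one_lt_card (α := F)
  let p : Polynomial K := Polynomial.X ^ Fintype.card F - Polynomial.X
  have hp : p ≠ 0 := FiniteField.X_pow_card_sub_X_ne_zero K hq
  have hsub : Finset.univ.image (algebraMap F K) ⊆ p.roots.toFinset := by
    intro y hy
    obtain ⟨a, -, rfl⟩ := Finset.mem_image.1 hy
    rw [Multiset.mem_toFinset, Polynomial.mem_roots hp]
    simp [p, ← map_pow, FiniteField.pow_card]
  have hcard : p.roots.toFinset.card ≤ (Finset.univ.image (algebraMap F K)).card := by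
    rw [Finset.card_image_of_injective _ (algebraMap F K).injective, Finset.card_univ]
    refine (Multiset.toFinset_card_le _).trans ((Polynomial.card_roots' p).trans (le_of_eq ?_))
    exact FiniteField.X_pow_card_sub_X_natDegree_eq K hq
  have hmem : x ∈ p.roots.toFinset := by
    rw [Multiset.mem_toFinset, Polynomial.mem_roots hp]
    simp [p, hx]
  rw [← Finset.eq_of_subset_of_card_le hsub hcard] at hmem
  obtain ⟨a, -, ha⟩ := Finset.mem_image.1 hmem
  exact ⟨a, ha⟩

theorem exists_quadratic_extension (F : Type*) [Field F] [Fintype F] :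
    ∃ (K : Type) (_ : Field K) (_ : Algebra F K) (ω : K),
      orderOf ω = Fintype.card F ^ 2 - 1 := by
  obtain ⟨p, hp⟩ := CharP.exists F
  have : Fact p.Prime := ⟨CharP.char_is_prime F p⟩
  obtain ⟨ω, hω⟩ := IsCyclic.exists_ofOrder_eq_natCard (α := (FiniteField.Extension F p 2)ˣ)
  refine ⟨FiniteField.Extension F p 2, inferInstance, inferInstance, ω, ?_⟩
  rw [orderOf_units, hω, Nat.card_units, FiniteField.natCard_extension, Nat.card_eq_fintype_card]

/-- The `(t, i)` entry `(ω ^ (q i + (r - 1 - i))) ^ t` of a matrix any `r` of whose first `q + 1`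
rows are linearly independent if `ω` has order `q ^ 2 - 1`. -/
def singerEntry {K : Type*} [Field K] (ω : K) (q r t i : ℕ) : K :=
  (ω ^ (q * i + (r - 1 - i))) ^ t

section Singer

variable {K : Type*} [Field K] {ω : K} {q : ℕ}

theorem singerEntry_add (r t t' i : ℕ) :
    singerEntry ω q r (t + t') i = singerEntry ω q r t i * singerEntry ω q r t' i :=
  pow_add _ _ _

theorem singerEntry_eq (hq : 0 < q) {r i : ℕ} (hi : i < r) (t : ℕ) :
    singerEntry ω q r t i = (ω ^ (r - 1)) ^ t * ((ω ^ (q - 1)) ^ t) ^ i := by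
  obtain ⟨q, rfl⟩ := Nat.exists_eq_add_of_lt hq
  obtain ⟨s, rfl⟩ := Nat.exists_eq_add_of_lt hi
  rw [singerEntry, show i + s + 1 - 1 - i = s by omega, show i + s + 1 - 1 = i + s by omega,
    show 0 + q + 1 - 1 = q by omega]
  ring

/-- Since `ω ^ (q ^ 2) = ω`, raising to the power `q` swaps the roles of `i` and `r - 1 - i` in the
exponent. -/
theorem singerEntry_pow_card (hω : ω ^ (q ^ 2) = ω) {r i : ℕ} (hi : i < r) (t : ℕ) :
    singerEntry ω q r t i ^ q = singerEntry ω q r t (r - (i + 1)) := by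
  obtain ⟨s, rfl⟩ := Nat.exists_eq_add_of_lt hi
  rw [singerEntry, singerEntry, show i + s + 1 - 1 - i = s by omega,
    show i + s + 1 - (i + 1) = s by omega, show i + s + 1 - 1 - s = i by omega, ← pow_mul,
    mul_comm t q, pow_mul]
  congr 1
  rw [← pow_mul, add_mul, pow_add, pow_add, mul_right_comm, ← pow_two, pow_mul, hω, mul_comm,
    mul_comm s]

/-- The nodes are powers of `ω ^ (q - 1)`, of order `q + 1`, hence distinct at positions `0` to `q`;
this is where the bound on the field size comes from. -/
theorem singerEntry_independent (hω : orderOf ω = q ^ 2 - 1) (hq : 1 < q) {ν : Type*}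
    {S : Finset ν} {pos : ν → ℕ} (hpos : Function.Injective pos) (hle : ∀ x, pos x ≤ q)
    {c : ν → K} {r : ℕ} (hS : S.card ≤ r)
    (h : ∀ i < r, ∑ x ∈ S, c x * singerEntry ω q r (pos x) i = 0) {z : ν} (hz : z ∈ S) :
    c z = 0 := by
  have hfac : q ^ 2 - 1 = (q - 1) * (q + 1) := by
    rw [mul_comm, ← Nat.sq_sub_sq, one_pow]
  have hord : orderOf (ω ^ (q - 1)) = q + 1 := by
    rw [orderOf_pow_of_dvd (by omega) (by rw [hω, hfac]; exact dvd_mul_right _ _), hω, hfac,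
      Nat.mul_div_cancel_left _ (by omega)]
  have hω0 : ω ≠ 0 := by
    rintro rfl
    rw [orderOf_zero, hfac] at hω
    have := Nat.mul_pos (show 0 < q - 1 by omega) (show 0 < q + 1 by omega)
    omega
  have hinj : Set.InjOn (fun x => (ω ^ (q - 1)) ^ pos x) S := by
    intro x _ y _ hxy
    refine hpos (pow_injOn_Iio_orderOf ?_ ?_ hxy) <;> rw [hord, Set.mem_Iio, Nat.lt_succ_iff]
    exacts [hle x, hle y]
  have := eq_zero_of_sum_mul_pow_eq_zero hinj (c := fun x => c x * (ω ^ (r - 1)) ^ pos x) hS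
    (fun i hi => by
      rw [← h i hi]
      refine Finset.sum_congr rfl fun x _ => ?_
      rw [singerEntry_eq (by omega) hi, mul_assoc]) hz
  exact (mul_eq_zero.1 this).resolve_right (pow_ne_zero _ (pow_ne_zero _ hω0))

variable {F : Type*} [Field F] [Algebra F K]

theorem singer_vecMul {κ : Type*} [Fintype κ] {r n₀ : ℕ} {pos : κ → ℕ} {P : Matrix κ (Fin r) F}
    (hP : ∀ p, ∀ i < r, singerEntry ω q r (pos p) i =
      ∑ c, algebraMap F K (P p c) * singerEntry ω q r (n₀ + c) i)
    (m : κ → F) {i : ℕ} (hi : i < r) :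
    ∑ p, algebraMap F K (m p) * singerEntry ω q r (pos p) i =
      ∑ c, algebraMap F K (Matrix.vecMul m P c) * singerEntry ω q r (n₀ + c) i := by
  simp only [hP _ i hi, Matrix.vecMul, dotProduct, map_sum, map_mul, Finset.mul_sum,
    Finset.sum_mul, mul_assoc]
  exact Finset.sum_comm

/-- A codeword, with parities negated, is a linear relation between rows; one supported on at most
`r` positions must be zero. -/
theorem singer_isScalarMDS (hω : orderOf ω = q ^ 2 - 1) (hq : 1 < q) {κ : Type*} [Fintype κ]
    [DecidableEq κ] [Nonempty κ] {r n₀ : ℕ} {pos : κ → ℕ} {P : Matrix κ (Fin r) F}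
    (hP : ∀ p, ∀ i < r, singerEntry ω q r (pos p) i =
      ∑ c, algebraMap F K (P p c) * singerEntry ω q r (n₀ + c) i)
    (hpos : Function.Injective pos) (hlt : ∀ p, pos p < n₀) (hn : n₀ + r ≤ q + 1) :
    IsScalarMDS (rowCode (sysGen P)) (Fintype.card κ) := by
  refine isScalarMDS_sysGen P fun m S hS hzero => ?_
  let pos' : κ ⊕ Fin r → ℕ := Sum.elim pos fun c => n₀ + c
  let w : κ ⊕ Fin r → K := Sum.elim (fun p => algebraMap F K (m p))
    fun c => -algebraMap F K (Matrix.vecMul m P c)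
  have hw : ∀ x ∉ S, w x = 0 := by
    intro x hx
    have := hzero x hx
    rcases x with p | c
    · rw [vecMul_sysGen_inl] at this
      simp [w, this]
    · rw [vecMul_sysGen_inr] at this
      simp [w, this]
  have hpos' : Function.Injective pos' := by
    refine hpos.sumElim (fun c d h => Fin.ext (Nat.add_left_cancel h)) fun p c h => ?_
    have := hlt p
    omega
  have hle : ∀ x, pos' x ≤ q := by
    rintro (p | c)
    · have : pos p < n₀ := hlt p
      change pos p ≤ q
      omega
    · have := c.2
      change n₀ + c ≤ q
      omega
  have hsum : ∀ i < r, ∑ x ∈ S, w x * singerEntry ω q r (pos' x) i = 0 := by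
    intro i hi
    rw [Finset.sum_subset (Finset.subset_univ S) fun x _ hx => by rw [hw x hx, zero_mul],
      Fintype.sum_sum_type]
    simp only [w, pos', Sum.elim_inl, Sum.elim_inr, neg_mul, Finset.sum_neg_distrib]
    rw [singer_vecMul hP m hi, add_neg_cancel]
  funext p
  have : w (Sum.inl p) = 0 := by
    by_cases hp : Sum.inl p ∈ S
    · exact singerEntry_independent hω hq hpos' hle (by simpa using hS) hsum hp
    · exact hw _ hp
  exact (map_eq_zero (algebraMap F K)).1 this

/-- Parities and the weighted row sum of the message determine each other. Row `l * k + s` is the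
entrywise product of rows `l * k` and `s`, so the final sum is a combination of the initial ones
with coefficients depending only on `l` and the column. -/
theorem singer_parity_computable (hω : orderOf ω = q ^ 2 - 1) (hq : 1 < q) {lam k r n₀ : ℕ}
    {PI : Matrix (Fin k) (Fin r) F} {PF : Matrix (Fin lam × Fin k) (Fin r) F}
    (hPI : ∀ s : Fin k, ∀ i < r, singerEntry ω q r s i =
      ∑ c, algebraMap F K (PI s c) * singerEntry ω q r (n₀ + c) i)
    (hPF : ∀ p : Fin lam × Fin k, ∀ i < r, singerEntry ω q r (p.1 * k + p.2) i =
      ∑ c, algebraMap F K (PF p c) * singerEntry ω q r (n₀ + c) i)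
    (hn : n₀ + r ≤ q + 1) (M M' : Fin lam × Fin k → F)
    (h : ∀ l, Matrix.vecMul (fun s => M (l, s)) PI = Matrix.vecMul (fun s => M' (l, s)) PI) :
    Matrix.vecMul M PF = Matrix.vecMul M' PF := by
  have hsum : ∀ i < r, ∑ c, algebraMap F K (Matrix.vecMul M PF c) * singerEntry ω q r (n₀ + c) i =
      ∑ c, algebraMap F K (Matrix.vecMul M' PF c) * singerEntry ω q r (n₀ + c) i := by
    intro i hi
    rw [← singer_vecMul (pos := fun p : Fin lam × Fin k => p.1 * k + p.2) hPF M hi,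
      ← singer_vecMul (pos := fun p : Fin lam × Fin k => p.1 * k + p.2) hPF M' hi,
      Fintype.sum_prod_type, Fintype.sum_prod_type]
    refine Finset.sum_congr rfl fun l _ => ?_
    have hl := singer_vecMul (pos := fun s : Fin k => (s : ℕ)) hPI (fun s => M (l, s)) hi
    rw [h l, ← singer_vecMul (pos := fun s : Fin k => (s : ℕ)) hPI (fun s => M' (l, s)) hi] at hl
    simp only [singerEntry_add, mul_left_comm _ (singerEntry ω q r (l * k) i), ← Finset.mul_sum]
    rw [hl]
  funext c
  refine (algebraMap F K).injective (sub_eq_zero.1 ?_)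
  refine singerEntry_independent hω hq (S := Finset.univ) (pos := fun c : Fin r => n₀ + c)
    (fun c d h => Fin.ext (Nat.add_left_cancel h)) (fun c => by have := c.2; omega) (r := r)
    (c := fun c => algebraMap F K (Matrix.vecMul M PF c) -
      algebraMap F K (Matrix.vecMul M' PF c)) (by simp) (fun i hi => ?_) (Finset.mem_univ c)
  simp only [sub_mul, Finset.sum_sub_distrib]
  rw [hsum i hi, sub_self]

/-- The rows of the matrix with entries `singerEntry` are combinations with coefficients in the
field with `q` elements of `r` consecutive ones. -/
theorem exists_singer_coeff [Fintype F] (hω : orderOf ω = Fintype.card F ^ 2 - 1) {r n₀ : ℕ}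
    (hn : n₀ + r ≤ Fintype.card F + 1) (t : ℕ) :
    ∃ a : Fin r → F, ∀ i < r, singerEntry ω (Fintype.card F) r t i =
      ∑ c, algebraMap F K (a c) * singerEntry ω (Fintype.card F) r (n₀ + c) i := by
  set q := Fintype.card F with hqdef
  have hq : 1 < q := Fintype.one_lt_card
  have hωq : ω ^ (q ^ 2) = ω := by
    obtain ⟨e, he⟩ := Nat.exists_eq_add_of_lt (Nat.pow_pos (n := 2) (show 0 < q by omega))
    rw [he, show 0 + e + 1 = e + 1 by omega, pow_succ,
      show e = orderOf ω by rw [hω, he]; omega, pow_orderOf_eq_one, one_mul]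
  let B : Matrix (Fin r) (Fin r) K := Matrix.of fun c i => singerEntry ω q r (n₀ + c) i
  have hB0 : ∀ w : Fin r → K, Matrix.vecMul w B = 0 → w = 0 := by
    intro w hw
    funext c
    refine singerEntry_independent hω hq (S := Finset.univ) (pos := fun c : Fin r => n₀ + c)
      (fun c d h => Fin.ext (Nat.add_left_cancel h)) (fun c => by have := c.2; omega)
      (c := w) (by simp) (fun i hi => congrFun hw ⟨i, hi⟩) (Finset.mem_univ c)
  have hdet : IsUnit B.det := by
    rw [isUnit_iff_ne_zero]
    intro h0
    obtain ⟨w, hw, hwB⟩ := Matrix.exists_vecMul_eq_zero_iff.2 h0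
    exact hw (hB0 w hwB)
  let v : Fin r → K := fun i => singerEntry ω q r t i
  let w : Fin r → K := Matrix.vecMul v B⁻¹
  have hw : ∀ i : Fin r, ∑ c, w c * singerEntry ω q r (n₀ + c) i = singerEntry ω q r t i := by
    intro i
    have : Matrix.vecMul w B = v := by
      rw [Matrix.vecMul_vecMul, Matrix.nonsing_inv_mul _ hdet, Matrix.vecMul_one]
    exact congrFun this i
  -- Applying Frobenius to the equation for column `Fin.rev i` gives the equation for column `i`
  -- with coefficients `w c ^ q`; uniqueness of coordinates puts them in `F`.
  have hfix : (fun c => w c ^ q) = w := by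
    refine sub_eq_zero.1 (hB0 _ ?_)
    rw [Matrix.sub_vecMul, sub_eq_zero]
    funext i
    have h1 := congrArg (FiniteField.frobeniusAlgHom F K) (hw (Fin.rev i))
    have hi := (Fin.rev i).2
    simp only [map_sum, map_mul, FiniteField.frobeniusAlgHom_apply, ← hqdef,
      singerEntry_pow_card hωq hi] at h1
    have hrev : r - ((Fin.rev i : ℕ) + 1) = i := by
      rw [Fin.val_rev]
      omega
    rw [hrev] at h1
    exact h1.trans (hw i).symm
  choose a ha using fun c => exists_algebraMap_eq_of_pow_card_eq (F := F) (congrFun hfix c)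
  exact ⟨a, fun i hi => by simp only [ha]; exact (hw ⟨i, hi⟩).symm⟩

end Singer

/-- Both codes place their parities at positions `lam * k` onwards, so `PI` consists of the first
`k` rows of `PF`. -/
theorem exists_isAccessOptimalBase {F : Type*} [Field F] [Fintype F] {lam k r : ℕ}
    (hlam : 0 < lam) (hk : 0 < k) (hq : lam * k + r ≤ Fintype.card F + 1) :
    ∃ (PI : Matrix (Fin k) (Fin r) F) (PF : Matrix (Fin lam × Fin k) (Fin r) F),
      IsAccessOptimalBase PI PF := by
  obtain ⟨K, _, _, ω, hω⟩ := exists_quadratic_extension F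
  choose a ha using exists_singer_coeff (F := F) (K := K) hω hq
  have hq1 : 1 < Fintype.card F := Fintype.one_lt_card
  have : Nonempty (Fin k) := ⟨⟨0, hk⟩⟩
  have : Nonempty (Fin lam) := ⟨⟨0, hlam⟩⟩
  have hPI : ∀ s : Fin k, ∀ i < r, singerEntry ω (Fintype.card F) r s i =
      ∑ c, algebraMap F K (a s c) * singerEntry ω (Fintype.card F) r (lam * k + c) i :=
    fun s => ha s
  have hPF : ∀ p : Fin lam × Fin k, ∀ i < r,
      singerEntry ω (Fintype.card F) r (p.1 * k + p.2) i =
        ∑ c, algebraMap F K (a (p.1 * k + p.2) c) *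
          singerEntry ω (Fintype.card F) r (lam * k + c) i := fun p => ha _
  have hinj : Function.Injective fun p : Fin lam × Fin k => (p.1 * k + p.2 : ℕ) := by
    intro p p' h
    have h1 := congrArg (· / k) h
    have h2 := congrArg (· % k) h
    simp only [mul_comm _ k, Nat.mul_add_div hk, Nat.mul_add_mod, Nat.div_eq_of_lt (Fin.is_lt _),
      Nat.mod_eq_of_lt (Fin.is_lt _), add_zero] at h1 h2
    exact Prod.ext (Fin.ext h1) (Fin.ext h2)
  have hlt : ∀ p : Fin lam × Fin k, (p.1 * k + p.2 : ℕ) < lam * k := by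
    intro p
    have h1 := Nat.mul_le_mul_right k (Nat.succ_le_of_lt p.1.2)
    have h2 := p.2.2
    rw [Nat.succ_mul] at h1
    omega
  refine ⟨Matrix.of fun s => a s, Matrix.of fun p => a (p.1 * k + p.2),
    IsAccessOptimalBase.of_parity_computable ?_ ?_ ?_⟩
  · have := singer_isScalarMDS (pos := fun s : Fin k => (s : ℕ)) hω hq1 hPI
      (fun s t h => Fin.ext h)
      (fun s => s.2.trans_le (Nat.le_mul_of_pos_left k hlam)) hq
    rwa [Fintype.card_fin] at this
  · have := singer_isScalarMDS (pos := fun p : Fin lam × Fin k => (p.1 * k + p.2 : ℕ)) hω hq1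
      hPF hinj hlt hq
    rwa [Fintype.card_prod, Fintype.card_fin, Fintype.card_fin] at this
  · exact singer_parity_computable hω hq1 hPI hPF hq

theorem mainTheorem8 {F : Type*} [Field F] [Fintype F] (lam k rI rF : ℕ)
    (hlam : 2 ≤ lam) (hr : rI < rF) (hk : rF < k) :
    (∀ (PI : Matrix (Fin k) (Fin rF) F) (PF : Matrix (Fin lam × Fin k) (Fin rF) F),
      IsAccessOptimalBase PI PF →
        (piggybackCode hr PI).IsLinear ∧ (piggybackCode hr PI).IsMDS ∧
        (VectorCode.instances (sysGen PF) (subPack rI rF)).IsLinear ∧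
        (VectorCode.instances (sysGen PF) (subPack rI rF)).IsMDS ∧
        ∃ T : Conversion (piggybackCode hr PI)
            (VectorCode.instances (sysGen PF) (subPack rI rF)),
          (∀ l s, T.origin (Sum.inl (l, s)) = some (l, Sum.inl s)) ∧
          (∀ i, T.origin (Sum.inr i) = none) ∧
          (∀ l s, T.ReadsExactly (l, Sum.inl s)
            (Finset.univ.filter fun j => subPackFree rI rF ≤ (j : ℕ))) ∧
          (∀ l i, T.ReadsExactly (l, Sum.inr i) Finset.univ) ∧
          (T.readBandwidth : ℚ) =
            lam * subPack rI rF * (rI + (1 - (rI : ℚ) / rF) * k) ∧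
          T.writeBandwidth = rF * subPack rI rF ∧
          T.IsBandwidthOptimal) ∧
    (lam * k + rF ≤ Fintype.card F + 1 →
      ∃ (PI : Matrix (Fin k) (Fin rF) F) (PF : Matrix (Fin lam × Fin k) (Fin rF) F),
        IsAccessOptimalBase PI PF) := by
  refine ⟨fun PI PF h => ⟨piggybackCode_isLinear hr PI, piggybackCode_isMDS hr h.initial_mds,
    VectorCode.instances_isLinear _ _, ?_,
    exists_piggyback_conversion hlam hr hk h.parity_computable⟩,
    exists_isAccessOptimalBase (by omega) (by omega)⟩
  exact IsScalarMDS.instances_isMDS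
    (by rw [Fintype.card_prod, Fintype.card_fin, Fintype.card_fin]; exact h.final_mds) _
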